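/- Let $D(0,1)$ be the linear space of càdlàg functions $[0,1]\to\mathbb{R}$ (right-continuous with left limits), endowed with the Skorokhod topology and the corresponding Borel $\sigma$-field, and let $C(0,1)$ be the linear space of continuous functions $[0,1]\to\mathbb{R}$ with the supremum norm. Let $\theta=(\theta_0,\theta_1)\in D(0,1)^2$. Let $\phi:D(0,1)^2\to\mathbb{R}$ be Hadamard differentiable at $\theta$ tangentially to $C(0,1)$ with respect to the supremum norm: there is a continuous linear map $\dot\phi_\theta:C(0,1)^2\to\mathbb{R}$ such that $$\frac{\phi(\theta+t_n h_n)-\phi(\theta)}{t_n}\longrightarrow\dot\phi_\theta(H)$$ for all $t_n>0$ with $t_n\to0$, all $h_n\in D(0,1)^2$ and all $H\in C(0,1)^2$ such that $h_n\to H$ in supremum norm in both coordinates. Assume that the derivative is of the form $\dot\phi_\theta(H_0,H_1)=g_\theta(H_0)$ for all $(H_0,H_1)\in C(0,1)^2$, where $g_\theta:C(0,1)\to\mathbb{R}$ is linear and continuous. For each $m$, let $\mathbb{Z}_{0,m}$ and $\mathbb{Z}_{1,m}$ be processes valued in $D(0,1)$, defined on a common probability space (which may depend on $m$), such that $\phi(\mathbb{Z}_{0,m},\mathbb{Z}_{1,m})$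 is measurable, i.e. a real random variable. Let $\mathbb{Z}_0$ and $\mathbb{Z}_1$ be two processes with values a.s. in $C(0,1)$. Let $(a_m)_m$ be a sequence of positive numbers tending to infinity, and assume that the following two convergences in distribution hold (separately) in $D(0,1)$, with respect to the Skorokhod topology and the corresponding Borel $\sigma$-field: $$a_m(\mathbb{Z}_{0,m}-\theta_0)\leadsto\mathbb{Z}_0,\qquad a_m(\mathbb{Z}_{1,m}-\theta_1)\leadsto\mathbb{Z}_1 .$$ Then $$a_m\bigl(\phi(\mathbb{Z}_{0,m},\mathbb{Z}_{1,m})-\phi(\theta)\bigr)\leadsto g_\theta(\mathbb{Z}_0)$$ in distribution. No joint convergence of the two processes is assumed. -/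

import Mathlib

open MeasureTheory Filter Topology Set unitInterval

noncomputable section

/-- A function `f : [0,1] → ℝ` is càdlàg if it is right-continuous and has (finite) left limits
at every point. (At `1` right-continuity is void, and at `0` the left limit is void.) -/
def IsCadlag (f : I → ℝ) : Prop :=
  ∀ t : I, ContinuousWithinAt f (Ici t) t ∧ ∃ l : ℝ, Tendsto f (𝓝[<] t) (𝓝 l)

/-- The càdlàg functions form a linear subspace of the space of all functions `[0,1] → ℝ`. -/
def cadlagSubmodule : Submodule ℝ (I → ℝ) where
  carrier := {f | IsCadlag f}
  zero_mem' := fun _ => ⟨continuousWithinAt_const, 0, tendsto_const_nhds⟩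
  add_mem' := by
    intro f g hf hg t
    obtain ⟨hf1, l, hl⟩ := hf t
    obtain ⟨hg1, k, hk⟩ := hg t
    exact ⟨hf1.add hg1, l + k, hl.add hk⟩
  smul_mem' := by
    intro c f hf t
    obtain ⟨hf1, l, hl⟩ := hf t
    exact ⟨hf1.const_smul c, c • l, hl.const_smul c⟩

/-- The linear space `D(0,1)` of càdlàg functions on `[0,1]`. It is a type of its own, so that its
topology is the Skorokhod topology defined below and not the one of pointwise convergence. -/
def CadlagSpace : Type := cadlagSubmodule

namespace CadlagSpace

instance : AddCommGroup CadlagSpace := inferInstanceAs (AddCommGroup cadlagSubmodule)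

instance : Module ℝ CadlagSpace := inferInstanceAs (Module ℝ cadlagSubmodule)

instance : FunLike CadlagSpace I ℝ where
  coe f := f.1
  coe_injective := Subtype.val_injective

theorem isCadlag (f : CadlagSpace) : IsCadlag f := f.2

@[simp] theorem add_apply (f g : CadlagSpace) (t : I) : (f + g) t = f t + g t := rfl

@[simp] theorem sub_apply (f g : CadlagSpace) (t : I) : (f - g) t = f t - g t := rfl

@[simp] theorem smul_apply (c : ℝ) (f : CadlagSpace) (t : I) : (c • f) t = c * f t := rfl

/-- The Skorokhod distance
`d(x, y) = inf_τ max (sup_t |τ t - t|) (sup_t |x t - y (τ t)|)`, where the time change `τ` runs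
over the increasing bijections of `[0,1]` onto itself (which are automatically homeomorphisms). -/
def skorokhodEDist (x y : CadlagSpace) : ENNReal :=
  ⨅ τ : I ≃o I, max (⨆ t : I, edist (τ t) t) (⨆ t : I, edist (x t) (y (τ t)))

theorem skorokhodEDist_self (x : CadlagSpace) : skorokhodEDist x x = 0 := by
  refine le_antisymm (iInf_le_of_le (OrderIso.refl I) ?_) bot_le
  simp

theorem skorokhodEDist_comm_le (x y : CadlagSpace) :
    skorokhodEDist x y ≤ skorokhodEDist y x := by
  refine le_iInf fun τ => iInf_le_of_le τ.symm (max_le_max ?_ ?_)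
  · refine iSup_le fun t => le_iSup_of_le (τ.symm t) ?_
    simp [edist_comm]
  · refine iSup_le fun t => le_iSup_of_le (τ.symm t) ?_
    simp [edist_comm]

theorem skorokhodEDist_triangle (x y z : CadlagSpace) :
    skorokhodEDist x z ≤ skorokhodEDist x y + skorokhodEDist y z := by
  unfold skorokhodEDist
  refine ENNReal.le_iInf_add_iInf fun τ ρ => iInf_le_of_le (τ.trans ρ) (max_le ?_ ?_)
  · refine iSup_le fun t => (edist_triangle _ (τ t) _).trans ?_
    rw [add_comm]
    exact add_le_add (le_max_of_le_left (le_iSup (fun t : I => edist (τ t) t) t))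
      (le_max_of_le_left (le_iSup (fun t : I => edist (ρ t) t) (τ t)))
  · refine iSup_le fun t => (edist_triangle _ (y (τ t)) _).trans ?_
    exact add_le_add (le_max_of_le_right (le_iSup (fun t : I => edist (x t) (y (τ t))) t))
      (le_max_of_le_right (le_iSup (fun t : I => edist (y t) (z (ρ t))) (τ t)))

/-- The Skorokhod (`J₁`) topology on `D(0,1)`: the topology of the Skorokhod distance. -/
instance : PseudoEMetricSpace CadlagSpace where
  edist := skorokhodEDist
  edist_self := skorokhodEDist_self
  edist_comm x y := le_antisymm (skorokhodEDist_comm_le x y) (skorokhodEDist_comm_le y x)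
  edist_triangle := skorokhodEDist_triangle

/-- `D(0,1)` carries the Borel `σ`-field of the Skorokhod topology. -/
instance : MeasurableSpace CadlagSpace := borel CadlagSpace

instance : BorelSpace CadlagSpace := ⟨rfl⟩

open Classical in
/-- The element of `C(0,1)` given by `f ∈ D(0,1)` when `f` is continuous. (The value `0` for
discontinuous `f` is a convention, used only on null sets.) -/
def toC (f : CadlagSpace) : C(I, ℝ) :=
  if hf : Continuous f then ⟨f, hf⟩ else 0

end CadlagSpace

/-- `φ : D(0,1)² → ℝ` is Hadamard differentiable at `θ` tangentially to `C(0,1)` (that is, to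
`C(0,1)²`) with respect to the supremum norm, with derivative the continuous linear map
`φ' : C(0,1)² → ℝ`: one has `(φ (θ + tₙ hₙ) - φ θ) / tₙ → φ' H` whenever `tₙ ↓ 0`, `hₙ ∈ D(0,1)²`,
`H ∈ C(0,1)²` and `hₙ → H` in supremum norm (i.e. uniformly, in both coordinates). -/
def HasHadamardDerivAt (φ : CadlagSpace × CadlagSpace → ℝ) (θ : CadlagSpace × CadlagSpace)
    (φ' : C(I, ℝ) × C(I, ℝ) →L[ℝ] ℝ) : Prop :=
  ∀ (t : ℕ → ℝ) (h : ℕ → CadlagSpace × CadlagSpace) (H : C(I, ℝ) × C(I, ℝ)),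
    (∀ n, 0 < t n) → Tendsto t atTop (𝓝 0) →
    TendstoUniformly (fun n s => (h n).1 s) H.1 atTop →
    TendstoUniformly (fun n s => (h n).2 s) H.2 atTop →
    Tendsto (fun n => (φ (θ + t n • h n) - φ θ) / t n) atTop (𝓝 (φ' H))

end

/-! Separate convergence suffices because the second process only has to stay near a compact set;
its limit never enters the derivative. A single law on the Polish space `C(I, ℝ)` is tight, so by
portmanteau each rescaled process lies, with probability close to one, in any given Skorokhod
neighbourhood of a compact set of continuous functions (`exists_isCompact_eventually_thickening`). A
union bound, blind to the joint law, handles the pair.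

Near such compacts the Hadamard expansion is uniform
(`HasHadamardDerivAt.exists_forall_thickening`), since Skorokhod convergence to a continuous limit
is uniform. The rescaled difference is thus close to `g H₀`, with `H₀` near the first process, and
portmanteau for that process alone concludes. -/

namespace CadlagSpace

/-- The inclusion of `C(0,1)` into `D(0,1)`. -/
def ofC (H : C(I, ℝ)) : CadlagSpace :=
  ⟨H, fun t => ⟨H.continuous.continuousWithinAt, H t, H.continuous.continuousWithinAt⟩⟩

@[simp] theorem ofC_apply (H : C(I, ℝ)) (t : I) : ofC H t = H t := rfl

theorem ofC_toC {f : CadlagSpace} (hf : Continuous f) : ofC f.toC = f := by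
  apply DFunLike.ext
  intro t
  simp [toC, hf]

@[simp] theorem toC_ofC (H : C(I, ℝ)) : (ofC H).toC = H := by
  have h : Continuous (ofC H) := H.continuous
  ext t
  simp [toC, h]

/-- A small Skorokhod distance provides a time change. -/
theorem exists_orderIso_of_edist_lt {x y : CadlagSpace} {ε : ENNReal} (h : edist x y < ε) :
    ∃ τ : I ≃o I, ∀ t, edist (τ t) t < ε ∧ edist (x t) (y (τ t)) < ε := by
  obtain ⟨τ, hτ⟩ := iInf_lt_iff.1 (show skorokhodEDist x y < ε from h)
  rw [max_lt_iff] at hτ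
  exact ⟨τ, fun t => ⟨(le_iSup (fun t => edist (τ t) t) t).trans_lt hτ.1,
    (le_iSup (fun t => edist (x t) (y (τ t))) t).trans_lt hτ.2⟩⟩

/-- Skorokhod convergence to a continuous limit is uniform. -/
theorem tendstoUniformly_of_tendsto {α : Type*} {l : Filter α} {u : α → CadlagSpace}
    {f : CadlagSpace} (hf : Continuous f) (h : Tendsto u l (𝓝 f)) :
    TendstoUniformly (fun a s => u a s) f l := by
  rw [EMetric.tendstoUniformly_iff]
  intro ε hε
  -- Uniform continuity of the limit absorbs the time change: `f s` is close to `f (τ s)`.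
  have huc := CompactSpace.uniformContinuous_of_continuous hf
  obtain ⟨δ, hδ, H⟩ := EMetric.uniformContinuous_iff.1 huc (ε / 2) (ENNReal.half_pos hε.ne')
  filter_upwards [(EMetric.tendsto_nhds.1 h) (min δ (ε / 2))
    (lt_min hδ (ENNReal.half_pos hε.ne'))] with a ha s
  obtain ⟨τ, hτ⟩ := exists_orderIso_of_edist_lt ha
  have h1 := H ((hτ s).1.trans_le (min_le_left _ _))
  have h2 := (hτ s).2.trans_le (min_le_right _ _)
  calc edist (f s) (u a s) ≤ edist (f s) (f (τ s)) + edist (f (τ s)) (u a s) :=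
        edist_triangle _ _ _
    _ < ε / 2 + ε / 2 := by
        rw [edist_comm (f s), edist_comm _ (u a s)]
        exact ENNReal.add_lt_add h1 h2
    _ = ε := ENNReal.add_halves ε

/-- The Skorokhod distance is bounded by the uniform distance. -/
theorem edist_le_of_forall {x y : CadlagSpace} {c : ENNReal} (h : ∀ t, edist (x t) (y t) ≤ c) :
    edist x y ≤ c :=
  iInf_le_of_le (OrderIso.refl I) (max_le (by simp) (iSup_le h))

theorem continuous_ofC : Continuous ofC := by
  refine continuous_iff_continuousAt.2 fun H => EMetric.tendsto_nhds.2 fun ε hε => ?_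
  filter_upwards [Metric.eball_mem_nhds H hε] with G hG
  refine lt_of_le_of_lt (edist_le_of_forall fun t => ?_) hG
  rw [edist_dist, edist_dist]
  exact ENNReal.ofReal_le_ofReal (ContinuousMap.dist_apply_le_dist t)

/-- The continuous functions form a Skorokhod closed subset of `D(0,1)`. -/
theorem isClosed_setOf_continuous : IsClosed {f : CadlagSpace | Continuous f} := by
  refine isClosed_of_closure_subset fun f hf => ?_
  refine continuous_of_uniform_approx_of_continuous fun u hu => ?_
  obtain ⟨ε, hε, hu⟩ := mem_uniformity_edist.1 hu
  obtain ⟨y, hy, hfy⟩ := EMetric.mem_closure_iff.1 hf ε hε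
  obtain ⟨τ, hτ⟩ := exists_orderIso_of_edist_lt hfy
  -- The time-changed approximant is still continuous and is uniformly close to `f`.
  exact ⟨fun t => y (τ t), hy.comp τ.continuous, fun t => hu (hτ t).2⟩

theorem continuousOn_toC : ContinuousOn toC {f | Continuous f} := by
  intro f hf
  rw [ContinuousWithinAt, ContinuousMap.tendsto_iff_tendstoUniformly]
  have h : TendstoUniformly (fun (x : CadlagSpace) s => x s) f (𝓝[{f | Continuous f}] f) :=
    tendstoUniformly_of_tendsto hf (tendsto_id'.2 nhdsWithin_le_nhds)
  have hf' : ⇑f.toC = ⇑f := by rw [← congrArg DFunLike.coe (ofC_toC hf)]; rfl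
  rw [hf']
  intro u hu
  filter_upwards [h u hu, self_mem_nhdsWithin] with x hxu hx s
  have hxs : x.toC s = x s := congrArg (fun y : CadlagSpace => y s) (ofC_toC hx)
  rw [hxs]
  exact hxu s

/-- Glues continuity on a closed set to the constant value off it. -/
theorem measurable_toC [MeasurableSpace C(I, ℝ)] [BorelSpace C(I, ℝ)] : Measurable toC := by
  refine measurable_of_restrict_of_restrict_compl isClosed_setOf_continuous.measurableSet
    (continuousOn_iff_continuous_domRestrict.1 continuousOn_toC).measurable ?_
  have : ({f : CadlagSpace | Continuous f}ᶜ).domRestrict toC = fun _ => 0 := by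
    ext1 f
    exact dif_neg f.2
  rw [this]
  exact measurable_const

/-- The continuous functions in the Skorokhod closure of the image of a closed `A ⊆ C(0,1)`
are those of `A`. -/
theorem toC_mem_of_mem_closure {A : Set C(I, ℝ)} (hA : IsClosed A) {f : CadlagSpace}
    (hf : f ∈ closure (ofC '' A)) : f.toC ∈ A := by
  have hsub : ofC '' A ⊆ {f | Continuous f} := by
    rintro _ ⟨H, -, rfl⟩
    exact H.continuous
  have hfc : Continuous f := isClosed_setOf_continuous.closure_subset_iff.2 hsub hf
  have h := ((continuousOn_toC f hfc).mono hsub).mem_closure_image hf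
  rw [image_image] at h
  simpa [hA.closure_eq] using h

end CadlagSpace

open CadlagSpace

/-- Hadamard differentiability gives a uniform expansion near compact subsets of `C(0,1)`. -/
theorem HasHadamardDerivAt.exists_forall_thickening {φ : CadlagSpace × CadlagSpace → ℝ}
    {θ : CadlagSpace × CadlagSpace} {φ' : C(I, ℝ) × C(I, ℝ) →L[ℝ] ℝ}
    (hφ : HasHadamardDerivAt φ θ φ') {a : ℕ → ℝ} (ha_pos : ∀ m, 0 < a m)
    (ha : Tendsto a atTop atTop) {K₀ K₁ : Set C(I, ℝ)} (hK₀ : IsCompact K₀) (hK₁ : IsCompact K₁)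
    {ε : ℝ} (hε : 0 < ε) :
    ∃ δ > 0, ∀ᶠ m in atTop, ∀ H₀ ∈ K₀, ∀ H₁ ∈ K₁, ∀ x y : CadlagSpace,
      edist x (ofC H₀) < δ → edist y (ofC H₁) < δ →
      |a m * (φ (θ + (a m)⁻¹ • (x, y)) - φ θ) - φ' (H₀, H₁)| < ε := by
  by_contra! hcon
  have hpos : ∀ n : ℕ, (0 : ENNReal) < ((n : ENNReal) + 1)⁻¹ := fun n => by simp
  have hlim : Tendsto (fun n : ℕ => ((n : ENNReal) + 1)⁻¹) atTop (𝓝 0) := by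
    simpa using (tendsto_add_atTop_iff_nat 1).2 ENNReal.tendsto_inv_nat_nhds_zero
  -- The indices `m n` need not increase; `m n ≥ n` is enough to send the step sizes to zero.
  have hbad : ∀ n : ℕ, ∃ m ≥ n, ∃ H₀ ∈ K₀, ∃ H₁ ∈ K₁, ∃ x y : CadlagSpace,
      edist x (ofC H₀) < ((n : ENNReal) + 1)⁻¹ ∧ edist y (ofC H₁) < ((n : ENNReal) + 1)⁻¹ ∧
      ε ≤ |a m * (φ (θ + (a m)⁻¹ • (x, y)) - φ θ) - φ' (H₀, H₁)| := fun n =>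
    frequently_atTop.1 (hcon _ (hpos n)) n
  choose m hm H₀ hH₀ H₁ hH₁ x y hx hy hbig using hbad
  obtain ⟨⟨G₀, G₁⟩, -, κ, hκ, hG⟩ := (hK₀.prod hK₁).tendsto_subseq
    (x := fun n => (H₀ n, H₁ n)) fun n => ⟨hH₀ n, hH₁ n⟩
  have hconv : ∀ {z : ℕ → CadlagSpace} {H : ℕ → C(I, ℝ)} {G : C(I, ℝ)},
      (∀ n, edist (z n) (ofC (H n)) < ((n : ENNReal) + 1)⁻¹) →
      Tendsto (fun n => H (κ n)) atTop (𝓝 G) →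
      TendstoUniformly (fun n s => z (κ n) s) G atTop := by
    intro z H G hz hH
    refine tendstoUniformly_of_tendsto (f := ofC G) G.continuous ?_
    have h1 := tendsto_iff_edist_tendsto_0.1 ((continuous_ofC.tendsto G).comp hH)
    have h2 := (hlim.comp hκ.tendsto_atTop).add h1
    rw [add_zero] at h2
    refine tendsto_iff_edist_tendsto_0.2 (tendsto_of_tendsto_of_tendsto_of_le_of_le
      tendsto_const_nhds h2 (fun _ => zero_le) fun n => ?_)
    exact (edist_triangle _ (ofC (H (κ n))) _).trans (add_le_add_left (hz (κ n)).le _)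
  have hm_lim : Tendsto (fun n => m (κ n)) atTop atTop :=
    (tendsto_atTop_mono hm tendsto_id).comp hκ.tendsto_atTop
  have key := hφ (fun n => (a (m (κ n)))⁻¹) (fun n => (x (κ n), y (κ n))) (G₀, G₁)
    (fun n => inv_pos.2 (ha_pos _)) (tendsto_inv_atTop_zero.comp (ha.comp hm_lim))
    (hconv hx ((continuous_fst.tendsto _).comp hG))
    (hconv hy ((continuous_snd.tendsto _).comp hG))
  -- The quotient and `φ' (H₀, H₁)` share the limit `φ' (G₀, G₁)`, so their gap cannot stay above
  -- `ε`.
  have h0 := (key.sub ((φ'.continuous.tendsto _).comp hG)).abs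
  rw [sub_self, abs_zero] at h0
  obtain ⟨n, hn⟩ := (h0.eventually_lt_const hε).exists
  refine absurd hn (not_lt.2 ((hbig (κ n)).trans_eq ?_))
  simp [div_inv_eq_mul, mul_comm]

/-- Under convergence in distribution, the limsup inequality of the portmanteau theorem. -/
theorem MeasureTheory.TendstoInDistribution.eventually_measure_lt {ι E Ω' : Type*}
    {Ω : ι → Type*} [∀ i, MeasurableSpace (Ω i)] {μ : ∀ i, Measure (Ω i)}
    [∀ i, IsProbabilityMeasure (μ i)] [MeasurableSpace Ω'] {μ' : Measure Ω'}
    [IsProbabilityMeasure μ'] [TopologicalSpace E] [MeasurableSpace E] [OpensMeasurableSpace E]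
    [HasOuterApproxClosed E] {X : ∀ i, Ω i → E} {l : Filter ι} {Z : Ω' → E}
    (h : TendstoInDistribution X l Z μ μ') {F : Set E} (hF : IsClosed F) {c : ENNReal}
    (hc : μ' (Z ⁻¹' F) < c) : ∀ᶠ i in l, μ i (X i ⁻¹' F) < c := by
  have h1 := ProbabilityMeasure.limsup_measure_closed_le_of_tendsto h.tendsto hF
  simp only [ProbabilityMeasure.coe_mk] at h1
  rw [Measure.map_apply_of_aemeasurable h.aemeasurable_limit hF.measurableSet] at h1
  filter_upwards [eventually_lt_of_limsup_lt (h1.trans_lt hc)] with i hi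
  rwa [Measure.map_apply_of_aemeasurable (h.forall_aemeasurable i) hF.measurableSet] at hi

/-- Convergence in distribution in `D(0,1)` to an a.s. continuous limit: the processes concentrate
on the neighbourhoods of a compact subset of `C(0,1)`. -/
theorem exists_isCompact_eventually_thickening {Ω : ℕ → Type*} [∀ m, MeasurableSpace (Ω m)]
    {P : ∀ m, Measure (Ω m)} [∀ m, IsProbabilityMeasure (P m)] {X : ∀ m, Ω m → CadlagSpace}
    {Ω₀ : Type*} [MeasurableSpace Ω₀] {P₀ : Measure Ω₀} [IsProbabilityMeasure P₀]
    {Z : Ω₀ → CadlagSpace} (hZ : ∀ᵐ ω ∂P₀, Continuous (Z ω))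
    (h : TendstoInDistribution X atTop Z P P₀) {ε : ENNReal} (hε : 0 < ε) (hε' : ε ≠ ⊤) :
    ∃ K : Set C(I, ℝ), IsCompact K ∧ ∀ δ > 0,
      ∀ᶠ m in atTop, P m (X m ⁻¹' (Metric.thickening δ (ofC '' K))ᶜ) < ε := by
  let : MeasurableSpace C(I, ℝ) := borel _
  have : BorelSpace C(I, ℝ) := ⟨rfl⟩
  have hmeas : AEMeasurable (fun ω => (Z ω).toC) P₀ :=
    measurable_toC.comp_aemeasurable h.aemeasurable_limit
  have := Measure.isProbabilityMeasure_map hmeas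
  obtain ⟨K, hK, hle⟩ := isTightMeasureSet_iff_exists_isCompact_measure_compl_le.1
    (isTightMeasureSet_singleton (μ := P₀.map fun ω => (Z ω).toC)) (ε / 2)
    (ENNReal.half_pos hε.ne')
  refine ⟨K, hK, fun δ hδ => h.eventually_measure_lt Metric.isOpen_thickening.isClosed_compl ?_⟩
  have hK' := hle _ rfl
  rw [Measure.map_apply_of_aemeasurable hmeas hK.isClosed.isOpen_compl.measurableSet] at hK'
  refine ((measure_mono_ae ?_).trans hK').trans_lt (ENNReal.half_lt_self hε.ne' hε')
  filter_upwards [hZ] with ω hω hmem hωK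
  refine hmem (Metric.self_subset_thickening hδ _ ⟨_, hωK, ofC_toC hω⟩)

/-- Partial functional delta method on `D(0,1)`. -/
theorem proposition9
    (θ₀ θ₁ : CadlagSpace)
    (φ : CadlagSpace × CadlagSpace → ℝ)
    (φ' : C(I, ℝ) × C(I, ℝ) →L[ℝ] ℝ)
    (hφ : HasHadamardDerivAt φ (θ₀, θ₁) φ')
    (g : C(I, ℝ) →L[ℝ] ℝ)
    (hg : ∀ H₀ H₁ : C(I, ℝ), φ' (H₀, H₁) = g H₀)
    -- the processes `Z₀ₘ`, `Z₁ₘ`, defined on a probability space that may depend on `m`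
    {Ω : ℕ → Type*} [∀ m, MeasurableSpace (Ω m)]
    (P : ∀ m, Measure (Ω m)) [∀ m, IsProbabilityMeasure (P m)]
    (Z₀ₘ Z₁ₘ : ∀ m, Ω m → CadlagSpace)
    -- the a.s. continuous limit processes, each on its own probability space
    {Ω₀ Ω₁ : Type*} [MeasurableSpace Ω₀] [MeasurableSpace Ω₁]
    (P₀ : Measure Ω₀) [IsProbabilityMeasure P₀] (P₁ : Measure Ω₁) [IsProbabilityMeasure P₁]
    (Z₀ : Ω₀ → CadlagSpace) (Z₁ : Ω₁ → CadlagSpace)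
    (hZ₀ : ∀ᵐ ω ∂P₀, Continuous (Z₀ ω)) (hZ₁ : ∀ᵐ ω ∂P₁, Continuous (Z₁ ω))
    (a : ℕ → ℝ) (ha_pos : ∀ m, 0 < a m) (ha : Tendsto a atTop atTop)
    (h₀ : TendstoInDistribution (fun m ω => a m • (Z₀ₘ m ω - θ₀)) atTop Z₀ P P₀)
    (h₁ : TendstoInDistribution (fun m ω => a m • (Z₁ₘ m ω - θ₁)) atTop Z₁ P P₁)
    -- `φ (Z₀ₘ, Z₁ₘ)` is a random variable
    (hmeas : ∀ m, AEMeasurable (fun ω => φ (Z₀ₘ m ω, Z₁ₘ m ω)) (P m)) :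
    TendstoInDistribution
      (fun m ω => a m * (φ (Z₀ₘ m ω, Z₁ₘ m ω) - φ (θ₀, θ₁))) atTop
      (fun ω => g (Z₀ ω).toC) P P₀ := by
  have hX : ∀ m ω, (θ₀, θ₁) + (a m)⁻¹ • (a m • (Z₀ₘ m ω - θ₀), a m • (Z₁ₘ m ω - θ₁)) =
      (Z₀ₘ m ω, Z₁ₘ m ω) := fun m ω => by
    ext1 <;> simp [smul_smul, (ha_pos m).ne']
  have hT : ∀ m, AEMeasurable (fun ω => a m * (φ (Z₀ₘ m ω, Z₁ₘ m ω) - φ (θ₀, θ₁))) (P m) :=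
    fun m => ((hmeas m).sub_const _).const_mul _
  have hW : AEMeasurable (fun ω => g (Z₀ ω).toC) P₀ := by
    let : MeasurableSpace C(I, ℝ) := borel _
    have : BorelSpace C(I, ℝ) := ⟨rfl⟩
    exact g.continuous.measurable.comp_aemeasurable
      (measurable_toC.comp_aemeasurable h₀.aemeasurable_limit)
  refine ⟨hT, hW, tendsto_of_forall_isClosed_limsup_le' fun F hF => ?_⟩
  simp only [ProbabilityMeasure.coe_mk]
  refine ENNReal.le_of_forall_pos_le_add fun ε hε _ => limsup_le_of_le (by isBoundedDefault) ?_
  -- One third for each compact, one for enlarging `F`.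
  have hε3 : (0 : ENNReal) < ε / 3 := ENNReal.div_pos (by simpa using hε.ne') (by simp)
  have hε3' : (ε / 3 : ENNReal) ≠ ⊤ := ENNReal.div_ne_top (by simp) (by simp)
  have := Measure.isProbabilityMeasure_map hW
  have := Measure.isProbabilityMeasure_map h₀.aemeasurable_limit
  obtain ⟨K₀, hK₀, hX₀⟩ := exists_isCompact_eventually_thickening hZ₀ h₀ hε3 hε3'
  obtain ⟨K₁, hK₁, hX₁⟩ := exists_isCompact_eventually_thickening hZ₁ h₁ hε3 hε3'
  obtain ⟨r, hr, hr_pos⟩ : ∃ r, P₀.map (fun ω => g (Z₀ ω).toC) (Metric.cthickening r F) <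
      P₀.map (fun ω => g (Z₀ ω).toC) F + ε / 3 ∧ 0 < r :=
    ((((tendsto_measure_cthickening_of_isClosed ⟨1, one_pos, measure_ne_top _ _⟩ hF).mono_left
      nhdsWithin_le_nhds).eventually_lt_const (ENNReal.lt_add_right (measure_ne_top _ _)
        hε3.ne')).and (self_mem_nhdsWithin (s := Ioi 0))).exists
  set A : Set C(I, ℝ) := K₀ ∩ g ⁻¹' Metric.cthickening r F with hA_def
  have hA : IsClosed A := hK₀.isClosed.inter (Metric.isClosed_cthickening.preimage g.continuous)
  have hclosure : P₀.map Z₀ (closure (ofC '' A)) <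
      P₀.map (fun ω => g (Z₀ ω).toC) F + ε / 3 := by
    refine lt_of_le_of_lt ?_ hr
    rw [Measure.map_apply_of_aemeasurable h₀.aemeasurable_limit isClosed_closure.measurableSet,
      Measure.map_apply_of_aemeasurable hW Metric.isClosed_cthickening.measurableSet]
    exact measure_mono fun ω hω => (toC_mem_of_mem_closure hA hω).2
  -- Portmanteau needs a closed set that also contains a neighbourhood of `A`, hence a closed
  -- thickening.
  obtain ⟨q, hq, hq_pos⟩ : ∃ q, P₀.map Z₀ (Metric.cthickening q (ofC '' A)) <
      P₀.map (fun ω => g (Z₀ ω).toC) F + ε / 3 ∧ 0 < q :=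
    ((((tendsto_measure_cthickening ⟨1, one_pos, measure_ne_top _ _⟩).mono_left
      nhdsWithin_le_nhds).eventually_lt_const hclosure).and
        (self_mem_nhdsWithin (s := Ioi 0))).exists
  rw [Measure.map_apply_of_aemeasurable h₀.aemeasurable_limit
    Metric.isClosed_cthickening.measurableSet] at hq
  obtain ⟨δ, hδ, hexp⟩ := hφ.exists_forall_thickening ha_pos ha hK₀ hK₁ hr_pos
  -- `δ` may be infinite; the minimum with `q` makes `toReal` harmless.
  obtain ⟨d, hd_pos, hdδ, hdq⟩ : ∃ d : ℝ, 0 < d ∧ ENNReal.ofReal d ≤ δ ∧ d ≤ q := by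
    refine ⟨(min δ (ENNReal.ofReal q)).toReal, ENNReal.toReal_pos ?_ ?_, ?_, ?_⟩
    · exact (lt_min hδ (ENNReal.ofReal_pos.2 hq_pos)).ne'
    · exact ne_top_of_le_ne_top ENNReal.ofReal_ne_top (min_le_right _ _)
    · exact ENNReal.ofReal_toReal_le.trans (min_le_left _ _)
    · exact ENNReal.toReal_le_of_le_ofReal hq_pos.le (min_le_right _ _)
  filter_upwards [hexp, hX₀ d hd_pos, hX₁ d hd_pos,
    h₀.eventually_measure_lt Metric.isClosed_cthickening hq] with m hexp hm₀ hm₁ hmA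
  rw [Measure.map_apply_of_aemeasurable (hT m) hF.measurableSet]
  calc _ ≤ P m ((_ ∪ _) ∪ _) := measure_mono ?_
    _ ≤ _ := (measure_union_le _ _).trans (add_le_add_left (measure_union_le _ _) _)
    _ ≤ _ := add_le_add (add_le_add hmA.le hm₀.le) hm₁.le
    _ = _ := by rw [add_assoc, add_assoc, ← add_assoc (ε / 3 : ENNReal), ENNReal.add_thirds]
  -- Off the two escape events, the expansion puts `g H₀` within `r` of `F`, so `H₀ ∈ A` and the
  -- first process is within `q` of `A`.
  intro ω hω
  by_contra hcon
  simp only [mem_union, mem_preimage, mem_compl_iff, not_or, not_not] at hcon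
  obtain ⟨⟨hnA, hx⟩, hy⟩ := hcon
  obtain ⟨_, ⟨H₀, hH₀, rfl⟩, hx⟩ := (Metric.mem_thickening_iff_exists_edist_lt _ _).1 hx
  obtain ⟨_, ⟨H₁, hH₁, rfl⟩, hy⟩ := (Metric.mem_thickening_iff_exists_edist_lt _ _).1 hy
  have hclose := hexp H₀ hH₀ H₁ hH₁ _ _ (hx.trans_le hdδ) (hy.trans_le hdδ)
  rw [hX, hg, abs_sub_comm] at hclose
  refine hnA (Metric.cthickening_mono hdq _ (Metric.thickening_subset_cthickening _ _
    ((Metric.mem_thickening_iff_exists_edist_lt _ _).2 ⟨_, ⟨H₀, ⟨hH₀, ?_⟩, rfl⟩, hx⟩)))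
  exact Metric.thickening_subset_cthickening _ _
    (Metric.mem_thickening_iff.2 ⟨_, hω, (Real.dist_eq _ _).trans_lt hclose⟩)
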